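/- Let $G$ be a finite group acting faithfully by conformal automorphisms on a compact connected Riemann surface $S$, and let $\pi_G:S\to T=S/G$ be the quotient map onto the quotient Riemann surface. The cone points of $T$ are the images of the points of $S$ with nontrivial stabilizer. Let $\mathcal E\subset T$ be a cut system with $k$ edges, that is, a finite embedded graph (loops and multiple edges allowed) such that: every cone point is a vertex; the edges are smooth regular arcs with definite tangents at their end points, which meet each other, themselves and the vertices only at end points; distinct arc ends at a common vertex have distinct tangents; no regular (non-cone) point is a vertex of valency $1$; and $T-\mathcal E$ is an open disc. A lifted edge is a connected component of $\pi_G^{-1}(e)$ for an open edge $e$ of $\mathcal E$. Let $\mathcal P^\circ$ be a connected component of $S-\pi_G^{-1}(\mathcal E)$, let $\tilde v_0\in\mathcal P^\circ$ and $v_0=\pi_G(\tilde v_0)$; the lifted open polygons are the translates $g\mathcal P^\circ$, $g\in G$. For each edge $e$ choose a crossover loop $\delta_e$: a simple loop in $T$ based at $v_0$ that meets $\mathcal E$ exactly once, at an interior point of $e$, and crosses $e$ transversally there. For a loop $\gamma$ at $v_0$ avoiding the cone points, let $\xi(\gamma)\in G$ be the unique element such that the lift of $\gamma$ to $S$ starting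 at $\tilde v_0$ ends at $\xi(\gamma)\tilde v_0$. To the two orientations of $e$ associate the crossover transformations $\xi(\delta_e)$ and $\xi(\delta_e^{-1})$, and for an arbitrary ordering $(e_1,\dots,e_{2k})$ of the $2k$ oriented edges of $\mathcal E$ let $(\tau_{e_1},\dots,\tau_{e_{2k}})$ be the resulting crossover sequence. Let $g,h\in G$ be such that $g\mathcal P^\circ\ne h\mathcal P^\circ$. Then the closures of $g\mathcal P^\circ$ and $h\mathcal P^\circ$ in $S$ have at least one lifted edge in common if and only if $g^{-1}h$ occurs in the sequence $(\tau_{e_1},\dots,\tau_{e_{2k}})$. Moreover, the number of lifted edges contained in both closures equals the number of indices $j\in\{1,\dots,2k\}$ with $\tau_{e_j}=g^{-1}h$. -/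

import Mathlib

open scoped Manifold ContDiff Topology Pointwise

/-- The map `π : S → T` exhibits the Riemann surface `T` as the quotient of the Riemann surface `S`
by a conformal action of `G`: every element of `G` acts holomorphically, `π` is holomorphic and
surjective, and its fibres are exactly the `G`-orbits. (For compact `S` this determines `T`, as a
Riemann surface under `S`, up to a unique biholomorphism.) -/
structure IsConformalQuotient (G : Type*) [Group G] {S T : Type*}
    [TopologicalSpace S] [ChartedSpace ℂ S] [MulAction G S]
    [TopologicalSpace T] [ChartedSpace ℂ T] (π : S → T) : Prop where
  conformal_smul : ∀ g : G, ContMDiff 𝓘(ℂ) 𝓘(ℂ) ω (fun x : S => g • x)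
  holomorphic : ContMDiff 𝓘(ℂ) 𝓘(ℂ) ω π
  surjective : Function.Surjective π
  fibre_iff : ∀ x y : S, π x = π y ↔ ∃ g : G, g • x = y

/-- The cone points of the quotient: the images of the points with nontrivial stabilizer. -/
def conePoints (G : Type*) [Group G] {S T : Type*} [MulAction G S] (π : S → T) : Set T :=
  π '' {x : S | MulAction.stabilizer G x ≠ ⊥}

section Curves

variable {T : Type*} [TopologicalSpace T] [ChartedSpace ℂ T]

/-- The velocity of a curve `γ` at time `t`, read in the preferred chart at `γ t`. -/
noncomputable def chartVelocity (γ : ℝ → T) (t : ℝ) : ℂ :=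
  deriv (fun s => chartAt ℂ (γ t) (γ s)) t

/-- The curve `γ`, starting at time `0`, leaves its starting point with the definite unit tangent
direction `u`, read in the preferred chart at `γ 0`. -/
def HasInitialDirection (γ : ℝ → T) (u : ℂ) : Prop :=
  Filter.Tendsto
    (fun t : ℝ => ‖chartAt ℂ (γ 0) (γ t) - chartAt ℂ (γ 0) (γ 0)‖⁻¹ •
      (chartAt ℂ (γ 0) (γ t) - chartAt ℂ (γ 0) (γ 0)))
    (𝓝[>] 0) (𝓝 u)

end Curves

/-- A finite graph with `k` edges embedded in the surface `T`. The edges are arcs parametrized by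
`[0, 1]` (only the values there matter); loops and multiple edges are allowed. The arcs are smooth
and regular, and meet each other, themselves and the vertices only at end points. -/
structure EmbeddedGraph (T : Type*) [TopologicalSpace T] [ChartedSpace ℂ T] (k : ℕ) where
  vertices : Set T
  finite_vertices : vertices.Finite
  arc : Fin k → ℝ → T
  continuousOn_arc : ∀ i, ContinuousOn (arc i) (Set.Icc 0 1)
  smooth_arc : ∀ i, ∀ t ∈ Set.Ioo (0 : ℝ) 1,
    ContDiffAt ℝ ∞ (fun s => chartAt ℂ (arc i t) (arc i s)) t
  regular_arc : ∀ i, ∀ t ∈ Set.Ioo (0 : ℝ) 1, chartVelocity (arc i) t ≠ 0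
  arc_zero_mem : ∀ i, arc i 0 ∈ vertices
  arc_one_mem : ∀ i, arc i 1 ∈ vertices
  arc_notMem : ∀ i, ∀ t ∈ Set.Ioo (0 : ℝ) 1, arc i t ∉ vertices
  injOn_arc : ∀ i, Set.InjOn (arc i) (Set.Ioo 0 1)
  disjoint_arc : ∀ i j, i ≠ j → Disjoint (arc i '' Set.Ioo 0 1) (arc j '' Set.Ioo 0 1)

namespace EmbeddedGraph

variable {T : Type*} [TopologicalSpace T] [ChartedSpace ℂ T] {k : ℕ}

/-- The open edge number `i`, as a subset of the surface. -/
def openEdge (E : EmbeddedGraph T k) (i : Fin k) : Set T :=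
  E.arc i '' Set.Ioo 0 1

/-- The subset of the surface covered by the graph. -/
def support (E : EmbeddedGraph T k) : Set T :=
  E.vertices ∪ ⋃ i, E.openEdge i

/-- The edge `p.1`, run through forwards if `p.2 = true` and backwards if `p.2 = false`.
The pairs `p` are the `2 * k` oriented edges of the graph. -/
def orientedArc (E : EmbeddedGraph T k) (p : Fin k × Bool) (t : ℝ) : T :=
  E.arc p.1 (if p.2 then t else 1 - t)

/-- The valency of a vertex: the number of oriented edges that start there (so that a loop
counts twice). -/
noncomputable def valency (E : EmbeddedGraph T k) (v : T) : ℕ :=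
  {p : Fin k × Bool | E.orientedArc p 0 = v}.ncard

/-- An embedded graph is a cut system of a surface with the given set of cone points if all cone
points are vertices, no regular point is a terminal vertex, the arcs have definite tangents at their
end points, arc ends meeting at a vertex have distinct tangents there, and the complement of the
graph is an open disc. -/
structure IsCutSystem (E : EmbeddedGraph T k) (cone : Set T) : Prop where
  cone_subset : cone ⊆ E.vertices
  terminal_mem_cone : ∀ v ∈ E.vertices, E.valency v = 1 → v ∈ cone
  exists_tangent : ∀ p : Fin k × Bool, ∃ u : ℂ, HasInitialDirection (E.orientedArc p) u
  distinct_tangents : ∀ p q : Fin k × Bool, p ≠ q → E.orientedArc p 0 = E.orientedArc q 0 →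
    ∀ u : ℂ, HasInitialDirection (E.orientedArc p) u → ¬ HasInitialDirection (E.orientedArc q) u
  complement_disc : Nonempty (↥(E.support)ᶜ ≃ₜ ↥(Metric.ball (0 : ℂ) 1))

/-- A crossover loop of the edge `i`: a simple loop, based at a point off the graph, that meets the
graph exactly once, namely at an interior point of the edge `i`, and crosses this edge
transversally there (the two velocities are linearly independent over `ℝ`). -/
structure IsCrossoverLoop (E : EmbeddedGraph T k) (i : Fin k) {v₀ : T} (δ : Path v₀ v₀) :
    Prop where
  simple : Set.InjOn δ.extend (Set.Ico 0 1)
  crossing : ∃ t ∈ Set.Ioo (0 : ℝ) 1, ∃ s ∈ Set.Ioo (0 : ℝ) 1,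
    δ.extend t = E.arc i s ∧
    (∀ t' ∈ Set.Icc (0 : ℝ) 1, t' ≠ t → δ.extend t' ∉ E.support) ∧
    LinearIndependent ℝ ![chartVelocity (E.arc i) s, chartVelocity δ.extend t]

end EmbeddedGraph

section Lifts

variable {G S T : Type*} [Group G] [TopologicalSpace S] [MulAction G S]
  [TopologicalSpace T] [ChartedSpace ℂ T] {k : ℕ}

/-- The lifted open polygon through `x`: the connected component of `x` in the complement of the
lift of the graph. -/
def liftedPolygon (π : S → T) (E : EmbeddedGraph T k) (x : S) : Set S :=
  connectedComponentIn (π ⁻¹' E.support)ᶜ x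

/-- The open edges of the lifted graph: the connected components of the preimages of the open
edges. -/
def liftedEdges (π : S → T) (E : EmbeddedGraph T k) : Set (Set S) :=
  {e | ∃ i : Fin k, ∃ x ∈ π ⁻¹' E.openEdge i, e = connectedComponentIn (π ⁻¹' E.openEdge i) x}

/-- The lifted (open) edges contained in the closures of both `P` and `Q`. -/
def sharedEdges (π : S → T) (E : EmbeddedGraph T k) (P Q : Set S) : Set (Set S) :=
  {e | e ∈ liftedEdges π E ∧ e ⊆ closure P ∩ closure Q}

open Classical in
/-- The monodromy of a loop `γ` in the quotient: the element `g` such that a lift of `γ` starting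
at `x₀` ends at `g • x₀`. For a loop avoiding the cone points this `g` exists and is unique; the
value `1` is a convention for loops without such a lift. -/
noncomputable def monodromy (G : Type*) [Group G] [MulAction G S] (π : S → T) (x₀ : S)
    (γ : Path (π x₀) (π x₀)) : G :=
  if h : ∃ g : G, ∃ Γ : Path x₀ (g • x₀), ∀ t, π (Γ t) = γ t then h.choose else 1

/-- The crossover transformation of an oriented edge `p`: the monodromy of the chosen crossover
loop of the edge, or of the reversed loop for the opposite orientation. -/
noncomputable def crossover (G : Type*) [Group G] [MulAction G S] (π : S → T) (x₀ : S)
    (δ : Fin k → Path (π x₀) (π x₀)) (p : Fin k × Bool) : G :=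
  monodromy G π x₀ (if p.2 then δ p.1 else (δ p.1).symm)

/-- The crossover sequence with respect to an ordering of the `2 * k` oriented edges. -/
noncomputable def crossoverSequence (G : Type*) [Group G] [MulAction G S] (π : S → T) (x₀ : S)
    (δ : Fin k → Path (π x₀) (π x₀)) (ord : Fin (2 * k) ≃ Fin k × Bool) : Fin (2 * k) → G :=
  fun j => crossover G π x₀ δ (ord j)

end Lifts

/-! Off the cone points `π` is a covering (`isCoveringMapOn`). The complement of the graph is a disc
and every open edge is an interval; both are simply connected and free of cone points, so `π` has
sections over them. Hence the translates of the polygon `P` of `x₀` by distinct group elements are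
distinct (`liftedPolygon_smul_inj`), and the lifted edges over the edge `i` form one free orbit.
Write `(i, a)` for the one through `a • q i`, where `q i` is the point at which the lift of `δ i`
crosses the lifted graph.

Near an interior point of an edge the graph is a line in a plane, so a lifted edge has two sides
there (`exists_sides`), and by connectedness it borders the same polygons along its whole length.
With `ξ i` the monodromy of `δ i`, the lifted loop passes from `P` to `ξ i • P` through `q i`
(`exists_crossing`), so `(i, a)` borders exactly `a • P` and `(a * ξ i) • P`. It is shared by the
translates by `g ≠ h` iff `a = g` and `ξ i = g⁻¹ * h`, or `a = h` and `(ξ i)⁻¹ = g⁻¹ * h`. These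
cases are the two orientations of the edge, which gives the bijection in
`exists_sharedEdges_eq_image`. If `ξ i` is an involution equal to `g⁻¹ * h`, both orientations
count, and they yield two different lifted edges. -/

theorem IsConformalQuotient.eq_one_of_smul_eq_self {G S T : Type*} [Group G] [MulAction G S] {π : S → T}
    {x : S} (hx : π x ∉ conePoints G π) {g : G} (hg : g • x = x) :
    g = 1 := by
  by_contra h1
  refine hx ⟨x, fun hbot => h1 ?_, rfl⟩
  rw [← Subgroup.mem_bot, ← hbot]
  exact hg

/-! ### The quotient map as a covering off the cone points -/

namespace IsConformalQuotient

variable {G S T : Type*} [Group G] [TopologicalSpace S] [ChartedSpace ℂ S] [MulAction G S]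
  [TopologicalSpace T] [ChartedSpace ℂ T] {π : S → T}

theorem continuousConstSMul (hπ : IsConformalQuotient G π) : ContinuousConstSMul G S :=
  ⟨fun g => (hπ.conformal_smul g).continuous⟩

theorem continuous (hπ : IsConformalQuotient G π) : Continuous π :=
  hπ.holomorphic.continuous

theorem map_smul (hπ : IsConformalQuotient G π) (g : G) (x : S) : π (g • x) = π x :=
  ((hπ.fibre_iff x (g • x)).2 ⟨g, rfl⟩).symm

theorem smul_connectedComponentIn (hπ : IsConformalQuotient G π) {A : Set T} (g : G)
    {x : S} (hx : π x ∈ A) :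
    g • connectedComponentIn (π ⁻¹' A) x = connectedComponentIn (π ⁻¹' A) (g • x) := by
  have := hπ.continuousConstSMul
  have key := (Homeomorph.smul g : S ≃ₜ S).image_connectedComponentIn (s := π ⁻¹' A) (x := x) hx
  have himg : (Homeomorph.smul g : S ≃ₜ S) '' (π ⁻¹' A) = π ⁻¹' A := by
    ext y
    constructor
    · rintro ⟨z, hz, rfl⟩
      simpa [hπ.map_smul] using hz
    · intro hy
      exact ⟨g⁻¹ • y, by simpa [hπ.map_smul] using hy, by simp⟩
  rw [himg] at key
  exact key

/-- A finite group acts properly discontinuously, and `π` is a quotient map because it is closed,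
from a compact to a Hausdorff space. Such a quotient is a covering over the images of points with
trivial stabilizer. -/
theorem isCoveringMapOn [Finite G] [T2Space S] [CompactSpace S] [T2Space T]
    (hπ : IsConformalQuotient G π) : IsCoveringMapOn π (conePoints G π)ᶜ := by
  have := hπ.continuousConstSMul
  have hq : Topology.IsQuotientMap π :=
    hπ.continuous.isClosedMap.isQuotientMap hπ.continuous hπ.surjective
  refine (hq.isCoveringMapOn_of_properlyDiscontinuousSMul (G := G) (fun {e₁ e₂} => ?_)).mono ?_
  · rw [eq_comm, hπ.fibre_iff]
    rfl
  · intro y hy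
    obtain ⟨x, rfl⟩ := hπ.surjective y
    refine ⟨x, ?_, rfl⟩
    by_contra h
    exact hy ⟨x, h, rfl⟩

end IsConformalQuotient

/-- Two lifts, along a map that is a covering over `B`, of the same map of a preconnected set
agree if they agree at a point. -/
theorem IsCoveringMapOn.eqOn_of_comp_eqOn {E X Y : Type*} [TopologicalSpace E] [TopologicalSpace X]
    [TopologicalSpace Y] {p : E → X} {B : Set X} (hp : IsCoveringMapOn p B) {s : Set Y}
    (hs : IsPreconnected s) {f₁ f₂ : Y → E} (h₁ : ContinuousOn f₁ s) (h₂ : ContinuousOn f₂ s)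
    (h : ∀ y ∈ s, p (f₁ y) = p (f₂ y)) (hB : ∀ y ∈ s, p (f₁ y) ∈ B) {a : Y} (ha : a ∈ s)
    (hfa : f₁ a = f₂ a) : s.EqOn f₁ f₂ := by
  have : PreconnectedSpace s := isPreconnected_iff_preconnectedSpace.1 hs
  let F₁ : s → p ⁻¹' B := fun y => ⟨f₁ y, hB y y.2⟩
  let F₂ : s → p ⁻¹' B := fun y => ⟨f₂ y, by
    show p (f₂ y) ∈ B
    rw [← h y y.2]
    exact hB y y.2⟩
  have hF := hp.isCoveringMap_restrictPreimage.eq_of_comp_eq (g₁ := F₁) (g₂ := F₂)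
    (h₁.domRestrict.subtype_mk _) (h₂.domRestrict.subtype_mk _)
    (funext fun y => Subtype.ext (h y y.2)) ⟨a, ha⟩ (Subtype.ext hfa)
  intro y hy
  exact congrArg Subtype.val (congrFun hF ⟨y, hy⟩)

/-! ### Components over simply connected sets -/

section Components

variable {G S T : Type*} [Group G] [Finite G] [TopologicalSpace S] [T2Space S] [CompactSpace S]
  [ChartedSpace ℂ S] [MulAction G S] [TopologicalSpace T] [T2Space T] [ChartedSpace ℂ T] {π : S → T}
  {A : Set T}

namespace IsConformalQuotient

/-- The components of the preimage of a simply connected set off the cone points are permuted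
simply transitively by `G`: the stabilizers are trivial. -/
theorem eq_one_of_smul_mem_connectedComponentIn (hπ : IsConformalQuotient G π)
    (hA : ∀ y ∈ A, y ∉ conePoints G π) {X : Type*} [TopologicalSpace X] [SimplyConnectedSpace X]
    [LocallyPathConnectedSpace X] (e : X ≃ₜ A) {x : S} (hx : π x ∈ A) {g : G}
    (hg : g • x ∈ connectedComponentIn (π ⁻¹' A) x) : g = 1 := by
  have hcov := hπ.isCoveringMapOn
  -- `σ` is the section over `A` through `x`. On the component `C` the identity and `σ ∘ π` lift the
  -- same map and agree at `x`, hence everywhere. So `π` is injective on `C`, and `g • x`, lying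
  -- over `π x`, equals `x`.
  obtain ⟨σ, ⟨hσx, hσ⟩, -⟩ := hcov.existsUnique_continuousMap_lifts
    (f := ⟨fun z => (e z : T), by fun_prop⟩) (a₀ := e.symm ⟨π x, hx⟩) (e₀ := x) (by simp)
    (fun a => hA _ (e a).2)
  have hσ' : ∀ z, π (σ z) = e z := fun z => congrFun hσ z
  let C := connectedComponentIn (π ⁻¹' A) x
  have hCA : C ⊆ π ⁻¹' A := connectedComponentIn_subset _ _
  classical
  let s : S → S := fun y => if h : π y ∈ A then σ (e.symm ⟨π y, h⟩) else y
  have hs : ∀ y (h : π y ∈ A), s y = σ (e.symm ⟨π y, h⟩) := fun y h => dif_pos h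
  have hsc : ContinuousOn s C := by
    rw [continuousOn_iff_continuous_domRestrict]
    have : C.domRestrict s = fun y : C => σ (e.symm ⟨π y, hCA y.2⟩) :=
      funext fun y => hs y (hCA y.2)
    rw [this]
    have := hπ.continuous
    fun_prop
  have hEq : C.EqOn id s := by
    refine hcov.eqOn_of_comp_eqOn isPreconnected_connectedComponentIn continuousOn_id hsc ?_ ?_
      (mem_connectedComponentIn hx) ?_
    · intro y hy
      rw [hs y (hCA hy), hσ']
      simp
    · intro y hy
      exact hA _ (hCA hy)
    · rw [hs x hx, hσx]
      rfl
  have h1 : g • x = s (g • x) := hEq hg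
  rw [hs _ (hCA hg)] at h1
  refine eq_one_of_smul_eq_self (hA _ hx) (h1.trans ?_)
  simp only [hπ.map_smul]
  exact hσx

/-- The components of the preimage of a simply connected set off the cone points are permuted
simply transitively by `G`: the action is transitive. -/
theorem exists_mem_connectedComponentIn (hπ : IsConformalQuotient G π)
    (hA : ∀ y ∈ A, y ∉ conePoints G π) {X : Type*} [TopologicalSpace X] [SimplyConnectedSpace X]
    [LocallyPathConnectedSpace X] (e : X ≃ₜ A) {x y : S} (hx : π x ∈ A) (hy : π y ∈ A) :
    ∃ g : G, y ∈ connectedComponentIn (π ⁻¹' A) (g • x) := by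
  obtain ⟨σ, ⟨hσx, hσ⟩, -⟩ := hπ.isCoveringMapOn.existsUnique_continuousMap_lifts
    (f := ⟨fun z => (e z : T), by fun_prop⟩) (a₀ := e.symm ⟨π x, hx⟩) (e₀ := x) (by simp)
    (fun a => hA _ (e a).2)
  have hσ' : ∀ z, π (σ z) = e z := fun z => congrFun hσ z
  -- The section meets the fibre of `y`, so some translate of its connected range contains both `g •
  -- x` and `y`.
  obtain ⟨g, hg⟩ := (hπ.fibre_iff (σ (e.symm ⟨π y, hy⟩)) y).1 (by simp [hσ'])
  refine ⟨g, ?_⟩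
  rw [← hπ.smul_connectedComponentIn g hx, ← hg]
  refine Set.smul_mem_smul_set ?_
  refine (isPreconnected_range σ.continuous).subset_connectedComponentIn ⟨_, hσx⟩ ?_
    (Set.mem_range_self _)
  rintro _ ⟨z, rfl⟩
  show π (σ z) ∈ A
  rw [hσ']
  exact (e z).2

end IsConformalQuotient

end Components

/-! ### Local normal form of the graph along an edge -/

/-- A curve in the plane with nonzero velocity `v` can be straightened by a local homeomorphism
whose second coordinate line through the given point has any prescribed velocity `w`
independent of `v`. -/
theorem exists_straightening {c : ℝ → ℂ} {s : ℝ} {v w : ℂ} (hc : HasStrictDerivAt c v s)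
    (hvw : LinearIndependent ℝ ![v, w]) :
    ∃ F : OpenPartialHomeomorph (ℝ × ℝ) ℂ, (s, 0) ∈ F.source ∧ (∀ p, F p = c p.1 + p.2 • w) ∧
      ∀ (γ : ℝ → ℂ) (t : ℝ), γ t = c s → HasDerivAt γ w t →
        HasDerivAt (fun τ => (F.symm (γ τ)).2) 1 t := by
  -- The derivative at `(s, 0)` of the map `(x, y) ↦ c x + y • w`; independence of `v` and `w` makes
  -- it invertible, so the inverse function theorem applies.
  let L₀ : ℝ × ℝ →L[ℝ] ℂ := (ContinuousLinearMap.fst ℝ ℝ ℝ).smulRight v +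
    (ContinuousLinearMap.snd ℝ ℝ ℝ).smulRight w
  have hL₀ : ∀ p, L₀ p = p.1 • v + p.2 • w := fun p => rfl
  have hinj : Function.Injective (L₀ : ℝ × ℝ →ₗ[ℝ] ℂ) := by
    rw [injective_iff_map_eq_zero]
    intro p hp
    have h0 : p.1 • v + p.2 • w = 0 := hp
    exact Prod.ext_iff.2 (LinearIndependent.pair_iff.1 hvw _ _ h0)
  let L : (ℝ × ℝ) ≃L[ℝ] ℂ := (LinearMap.linearEquivOfInjective _ hinj
    (by simp [Complex.finrank_real_complex])).toContinuousLinearEquiv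
  have hL : (L : ℝ × ℝ →L[ℝ] ℂ) = L₀ := by
    ext <;> rfl
  have hF : HasStrictFDerivAt (fun p : ℝ × ℝ => c p.1 + p.2 • w) (L : ℝ × ℝ →L[ℝ] ℂ) (s, 0) := by
    rw [hL]
    have hc' : HasStrictFDerivAt c (ContinuousLinearMap.toSpanSingleton ℝ v) ((s, 0) : ℝ × ℝ).1 :=
      hc.hasStrictFDerivAt
    refine ((hc'.comp (s, 0) hasStrictFDerivAt_fst).add
      (hasStrictFDerivAt_snd.smul_const w)).congr_fderiv ?_
    ext <;> simp [L₀]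
  refine ⟨hF.toOpenPartialHomeomorph _, hF.mem_toOpenPartialHomeomorph_source, fun p => rfl, ?_⟩
  intro γ t hγ hd
  have hsymm : HasFDerivAt (hF.toOpenPartialHomeomorph _).symm (L.symm : ℂ →L[ℝ] ℝ × ℝ) (γ t) := by
    have h1 := hF.to_localInverse.hasFDerivAt
    simp only [zero_smul, add_zero] at h1
    rw [hγ]
    exact h1
  have h2 := hasFDerivAt_snd.comp_hasDerivAt t (hsymm.comp_hasDerivAt t hd)
  have hw : L.symm w = (0, 1) := by
    rw [L.symm_apply_eq]
    show w = (L : ℝ × ℝ →L[ℝ] ℂ) (0, 1)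
    rw [hL, hL₀]
    simp
  have h3 : (ContinuousLinearMap.snd ℝ ℝ ℝ) ((L.symm : ℂ →L[ℝ] ℝ × ℝ) w) = 1 := by
    show (L.symm w).2 = 1
    rw [hw]
  rw [h3] at h2
  exact h2

namespace EmbeddedGraph

variable {T : Type*} [TopologicalSpace T] [ChartedSpace ℂ T] {k : ℕ} (E : EmbeddedGraph T k)

theorem openEdge_subset_support (i : Fin k) : E.openEdge i ⊆ E.support :=
  (Set.subset_iUnion E.openEdge i).trans Set.subset_union_right

theorem arc_mem_vertices {i : Fin k} {t : ℝ} (ht : t ∈ Set.Icc (0 : ℝ) 1)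
    (ht' : t ∉ Set.Ioo (0 : ℝ) 1) : E.arc i t ∈ E.vertices := by
  rcases eq_or_lt_of_le ht.1 with h0 | h0
  · exact h0 ▸ E.arc_zero_mem i
  · rcases eq_or_lt_of_le ht.2 with h1 | h1
    · exact h1 ▸ E.arc_one_mem i
    · exact absurd ⟨h0, h1⟩ ht'

theorem notMem_vertices_of_mem_openEdge {i : Fin k} {y : T} (hy : y ∈ E.openEdge i) :
    y ∉ E.vertices := by
  obtain ⟨t, ht, rfl⟩ := hy
  exact E.arc_notMem i t ht

theorem openEdge_eq_of_mem {i j : Fin k} {y : T} (hi : y ∈ E.openEdge i) (hj : y ∈ E.openEdge j) :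
    i = j := by
  by_contra h
  exact Set.disjoint_left.1 (E.disjoint_arc i j h) hi hj

theorem continuousAt_arc (i : Fin k) {s : ℝ} (hs : s ∈ Set.Ioo (0 : ℝ) 1) :
    ContinuousAt (E.arc i) s :=
  (E.continuousOn_arc i).continuousAt (Icc_mem_nhds hs.1 hs.2)

theorem isClosed_support [T2Space T] : IsClosed E.support := by
  have : E.support = E.vertices ∪ ⋃ i, E.arc i '' Set.Icc 0 1 := by
    ext y
    constructor
    · rintro (hy | hy)
      · exact Or.inl hy
      · obtain ⟨i, t, ht, rfl⟩ := Set.mem_iUnion.1 hy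
        exact Or.inr (Set.mem_iUnion.2 ⟨i, t, Set.Ioo_subset_Icc_self ht, rfl⟩)
    · rintro (hy | hy)
      · exact Or.inl hy
      · obtain ⟨i, t, ht, rfl⟩ := Set.mem_iUnion.1 hy
        by_cases h : t ∈ Set.Ioo (0 : ℝ) 1
        · exact E.openEdge_subset_support i ⟨t, h, rfl⟩
        · exact Or.inl (E.arc_mem_vertices ht h)
  rw [this]
  exact E.finite_vertices.isClosed.union
    (isClosed_iUnion_of_finite fun i => (isCompact_Icc.image_of_continuousOn
      (E.continuousOn_arc i)).isClosed)

/-- The part of the graph outside a neighbourhood of the interior point `s` of an arc is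
contained in a closed set that misses this point. -/
theorem exists_isClosed_remainder [T2Space T] {i : Fin k} {s : ℝ} (hs : s ∈ Set.Ioo (0 : ℝ) 1)
    {ε : ℝ} (hε : 0 < ε) :
    ∃ K : Set T, IsClosed K ∧ E.arc i s ∉ K ∧
      ∀ y ∈ E.support, y ∉ K → ∃ t ∈ Set.Ioo (0 : ℝ) 1, dist t s < ε ∧ y = E.arc i t := by
  -- The remainder consists of the vertices, the other closed arcs, and the part of this arc at
  -- parameter distance at least `ε` from `s`.
  refine ⟨E.vertices ∪ (⋃ j, ⋃ _ : j ≠ i, E.arc j '' Set.Icc 0 1) ∪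
    E.arc i '' (Set.Icc 0 1 \ Metric.ball s ε), ?_, ?_, ?_⟩
  · refine (E.finite_vertices.isClosed.union ?_).union ?_
    · exact isClosed_iUnion_of_finite fun j => isClosed_iUnion_of_finite fun _ =>
        (isCompact_Icc.image_of_continuousOn (E.continuousOn_arc j)).isClosed
    · exact ((isCompact_Icc.diff Metric.isOpen_ball).image_of_continuousOn
        ((E.continuousOn_arc i).mono Set.sdiff_subset)).isClosed
  · have hv := E.arc_notMem i s hs
    rintro ((h | h) | ⟨t, ⟨ht, htb⟩, h⟩)
    · exact hv h
    · simp only [Set.mem_iUnion] at h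
      obtain ⟨j, hj, t, ht, h⟩ := h
      by_cases ht' : t ∈ Set.Ioo (0 : ℝ) 1
      · exact hj (E.openEdge_eq_of_mem ⟨t, ht', h⟩ ⟨s, hs, rfl⟩)
      · exact hv (h ▸ E.arc_mem_vertices ht ht')
    · by_cases ht' : t ∈ Set.Ioo (0 : ℝ) 1
      · exact htb (by rw [E.injOn_arc i ht' hs h]; exact Metric.mem_ball_self hε)
      · exact hv (h ▸ E.arc_mem_vertices ht ht')
  · rintro y (hy | hy) hK
    · exact absurd (Or.inl (Or.inl hy)) hK
    · obtain ⟨j, t, ht, rfl⟩ := Set.mem_iUnion.1 hy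
      by_cases hj : j = i
      · subst hj
        refine ⟨t, ht, ?_, rfl⟩
        by_contra hd
        exact hK (Or.inr ⟨t, ⟨Set.Ioo_subset_Icc_self ht, hd⟩, rfl⟩)
      · refine absurd (Or.inl (Or.inr ?_)) hK
        simp only [Set.mem_iUnion]
        exact ⟨j, hj, t, Set.Ioo_subset_Icc_self ht, rfl⟩

/-- Near an interior point of an arc the graph looks like a line in the plane, and a curve
that crosses the arc with a given transverse velocity `w` changes sides. -/
theorem exists_box [T2Space T] {i : Fin k} {s : ℝ} (hs : s ∈ Set.Ioo (0 : ℝ) 1) {w : ℂ}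
    (hw : LinearIndependent ℝ ![chartVelocity (E.arc i) s, w]) {U : Set T}
    (hU : U ∈ 𝓝 (E.arc i s)) :
    ∃ r > 0, ∃ Ψ : OpenPartialHomeomorph (ℝ × ℝ) T, Ψ.source = Metric.ball (s, 0) r ∧
      Ψ.target ⊆ U ∧ Ψ (s, 0) = E.arc i s ∧ (∀ p ∈ Ψ.source, Ψ p ∈ E.support ↔ p.2 = 0) ∧
      ∀ (γ : ℝ → T) (t : ℝ), γ t = E.arc i s → ContinuousAt γ t → chartVelocity γ t = w →
        ∀ᶠ τ in 𝓝 t, SignType.sign (Ψ.symm (γ τ)).2 = SignType.sign (τ - t) := by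
  set q := E.arc i s with hq
  set φ := chartAt ℂ q with hφ
  set c : ℝ → ℂ := fun τ => φ (E.arc i τ) with hcdef
  have hc : HasStrictDerivAt c (chartVelocity (E.arc i) s) s :=
    (E.smooth_arc i s hs).hasStrictDerivAt (by simp)
  obtain ⟨F, hsF, hF, hFγ⟩ := exists_straightening hc hw
  have hF0 : F (s, 0) = φ q := by simp [hF, hcdef, hq]
  have hqφ : q ∈ φ.source := mem_chart_source ℂ q
  let Ψ₀ := F.trans φ.symm
  have hΨ₀s : (s, (0 : ℝ)) ∈ Ψ₀.source := by
    refine ⟨hsF, ?_⟩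
    show F (s, 0) ∈ φ.target
    rw [hF0]
    exact φ.map_source hqφ
  have hΨ₀q : Ψ₀ (s, 0) = q := by
    show φ.symm (F (s, 0)) = q
    rw [hF0, φ.left_inv hqφ]
  have hnear : ∀ᶠ p : ℝ × ℝ in 𝓝 (s, 0), p ∈ Ψ₀.source ∧ E.arc i p.1 ∈ φ.source ∧
      p.1 ∈ Set.Ioo (0 : ℝ) 1 := by
    refine Filter.Eventually.and (Ψ₀.open_source.mem_nhds hΨ₀s) (Filter.Eventually.and ?_
      (continuousAt_fst.eventually (isOpen_Ioo.mem_nhds hs)))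
    have h1 : ContinuousAt (fun p : ℝ × ℝ => E.arc i p.1) (s, 0) :=
      ContinuousAt.comp (f := Prod.fst) (x := ((s, 0) : ℝ × ℝ)) (E.continuousAt_arc i hs)
        continuousAt_fst
    exact h1 (φ.open_source.mem_nhds hqφ)
  obtain ⟨r₀, hr₀, hball₀⟩ := Metric.eventually_nhds_iff_ball.1 hnear
  have hline : ∀ x, ((x, 0) : ℝ × ℝ) ∈ Metric.ball ((s, 0) : ℝ × ℝ) r₀ →
      Ψ₀ (x, 0) = E.arc i x := by
    intro x hx
    show φ.symm (F (x, 0)) = E.arc i x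
    have : F (x, 0) = φ (E.arc i x) := by simp [hF, hcdef]
    rw [this, φ.left_inv (hball₀ _ hx).2.1]
  -- Outside `K` the graph is only the stretch of arc `i` already straightened; shrinking the box
  -- until it misses `K` keeps all other strands out.
  obtain ⟨K, hK, hqK, hKs⟩ := E.exists_isClosed_remainder hs hr₀
  have hnear' : ∀ᶠ p : ℝ × ℝ in 𝓝 (s, 0), Ψ₀ p ∈ U ∧ Ψ₀ p ∉ K := by
    refine (Ψ₀.continuousAt hΨ₀s).eventually (p := fun y => y ∈ U ∧ y ∉ K) ?_
    rw [hΨ₀q]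
    exact Filter.Eventually.and hU (hK.isOpen_compl.mem_nhds hqK)
  obtain ⟨r₁, hr₁, hball₁⟩ := Metric.eventually_nhds_iff_ball.1 hnear'
  have hr : 0 < min r₀ r₁ := lt_min hr₀ hr₁
  have hsub₀ := Metric.ball_subset_ball (x := ((s, 0) : ℝ × ℝ)) (min_le_left r₀ r₁)
  have hsub₁ := Metric.ball_subset_ball (x := ((s, 0) : ℝ × ℝ)) (min_le_right r₀ r₁)
  let Ψ := Ψ₀.restrOpen (Metric.ball ((s, 0) : ℝ × ℝ) (min r₀ r₁)) Metric.isOpen_ball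
  have hΨ : ∀ p, Ψ p = Ψ₀ p := fun p => rfl
  have hsrc : Ψ.source = Metric.ball ((s, 0) : ℝ × ℝ) (min r₀ r₁) := by
    rw [Ψ₀.restrOpen_source]
    exact Set.inter_eq_right.2 fun p hp => (hball₀ p (hsub₀ hp)).1
  refine ⟨min r₀ r₁, hr, Ψ, hsrc, ?_, hΨ₀q, ?_, ?_⟩
  · intro y hy
    have h1 := Ψ.map_target hy
    rw [hsrc] at h1
    rw [← Ψ.right_inv hy]
    exact (hball₁ _ (hsub₁ h1)).1
  · rw [hsrc]
    intro p hp
    have hp₀ := hball₀ _ (hsub₀ hp)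
    constructor
    · intro hps
      obtain ⟨x, -, hxd, hx⟩ := hKs _ hps (hball₁ _ (hsub₁ hp)).2
      have hxb : ((x, 0) : ℝ × ℝ) ∈ Metric.ball ((s, 0) : ℝ × ℝ) r₀ := by
        simpa [Prod.dist_eq, hr₀] using hxd
      have : p = (x, 0) := by
        refine Ψ₀.injOn hp₀.1 (hball₀ _ hxb).1 ?_
        rw [hline x hxb]
        exact hx
      rw [this]
    · intro hp2
      obtain ⟨x, y⟩ := p
      obtain rfl : y = 0 := hp2
      rw [hΨ, hline x (hsub₀ hp)]
      exact E.openEdge_subset_support i ⟨x, hp₀.2.2, rfl⟩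
  · intro γ t hγt hγc hγv
    have hw0 : w ≠ 0 := by
      simpa using hw.ne_zero 1
    have hd : HasDerivAt (fun τ => φ (γ τ)) w t := by
      have h1 : deriv (fun τ => φ (γ τ)) t = w := by
        rw [← hγv, chartVelocity, hγt]
      -- `deriv` is `0` where no derivative exists, so a nonzero velocity forces differentiability.
      have h2 : DifferentiableAt ℝ (fun τ => φ (γ τ)) t :=
        differentiableAt_of_deriv_ne_zero (by rw [h1]; exact hw0)
      exact h1 ▸ h2.hasDerivAt
    have hd' := hFγ (fun τ => φ (γ τ)) t (by simp [hcdef, hγt, hq]) hd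
    refine eventually_nhdsWithin_sign_eq_of_deriv_pos (f := fun τ => (Ψ.symm (γ τ)).2) ?_ ?_
    · have : deriv (fun τ => (Ψ.symm (γ τ)).2) t = 1 := hd'.deriv
      rw [this]
      exact one_pos
    · have : Ψ.symm (γ t) = (s, 0) := by
        rw [hγt]
        show F.symm (φ q) = (s, 0)
        rw [← hF0, F.left_inv hsF]
      simp [this]

end EmbeddedGraph

/-! ### Lifted polygons and the two sides of a lifted edge -/

section Polygons

variable {S T : Type*} [TopologicalSpace S] [TopologicalSpace T] [ChartedSpace ℂ T] {π : S → T}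
  {k : ℕ}

theorem liftedPolygon_eq_of_mem {E : EmbeddedGraph T k} {x y : S} (h : y ∈ liftedPolygon π E x) :
    liftedPolygon π E y = liftedPolygon π E x :=
  (connectedComponentIn_eq h).symm

theorem mem_liftedPolygon_self {E : EmbeddedGraph T k} {x : S} (h : π x ∉ E.support) :
    x ∈ liftedPolygon π E x :=
  mem_connectedComponentIn h

/-- A continuous image, off the lifted graph, of a preconnected set lies in one polygon. -/
theorem liftedPolygon_eq_of_isPreconnected {E : EmbeddedGraph T k} {X : Type*} [TopologicalSpace X]
    {A : Set X} (hA : IsPreconnected A) {f : X → S} (hf : ContinuousOn f A)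
    (h : ∀ a ∈ A, π (f a) ∉ E.support) {a b : X} (ha : a ∈ A) (hb : b ∈ A) :
    liftedPolygon π E (f a) = liftedPolygon π E (f b) := by
  refine liftedPolygon_eq_of_mem ((hA.image f hf).subset_connectedComponentIn
    (Set.mem_image_of_mem f hb) ?_ (Set.mem_image_of_mem f ha))
  rintro _ ⟨c, hc, rfl⟩
  exact h c hc

end Polygons

namespace IsConformalQuotient

variable {G S T : Type*} [Group G] [Finite G] [TopologicalSpace S] [T2Space S] [CompactSpace S]
  [ChartedSpace ℂ S] [MulAction G S] [TopologicalSpace T] [T2Space T] [ChartedSpace ℂ T] {π : S → T}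
  {k : ℕ}

/-- A point of a lifted edge has a neighbourhood in which the lifted edge has two sides, and a curve
that crosses the edge transversally passes from the polygon on one side to the one on the other. -/
theorem exists_sides (hπ : IsConformalQuotient G π) {E : EmbeddedGraph T k}
    (hE : conePoints G π ⊆ E.vertices) {i : Fin k} {s : ℝ} (hs : s ∈ Set.Ioo (0 : ℝ) 1) {w : ℂ}
    (hw : LinearIndependent ℝ ![chartVelocity (E.arc i) s, w]) {x : S} (hx : π x = E.arc i s) :
    ∃ N ∈ 𝓝 x, ∃ a b : S,
      (∀ x' ∈ N, π x' ∈ E.openEdge i → ∀ y, π y ∉ E.support →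
        (x' ∈ closure (liftedPolygon π E y) ↔
          liftedPolygon π E y = liftedPolygon π E a ∨
            liftedPolygon π E y = liftedPolygon π E b)) ∧
      ∀ (Γ : ℝ → S) (t : ℝ), Γ t = x → ContinuousAt Γ t → chartVelocity (fun τ => π (Γ τ)) t = w →
        ∀ᶠ τ in 𝓝 t, (t < τ → liftedPolygon π E (Γ τ) = liftedPolygon π E a) ∧
          (τ < t → liftedPolygon π E (Γ τ) = liftedPolygon π E b) := by
  have hloc := hπ.isCoveringMapOn.isLocalHomeomorphOn
  have hxc : π x ∉ conePoints G π := fun h => E.arc_notMem i s hs (hx ▸ hE h)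
  obtain ⟨e, hxe, he⟩ := hloc x hxc
  have hU : e.target ∈ 𝓝 (E.arc i s) := by
    rw [← hx, he]
    exact e.open_target.mem_nhds (e.map_source hxe)
  obtain ⟨r, hr, Ψ, hsrc, htgt, hΨ0, hΨs, hΨγ⟩ := E.exists_box hs hw hU
  let Φ := Ψ.trans e.symm
  have hΦs : Φ.source = Metric.ball (s, 0) r := by
    rw [← hsrc]
    exact Set.inter_eq_left.2 fun p hp => htgt (Ψ.map_source hp)
  have hπΦ : ∀ p ∈ Metric.ball ((s, 0) : ℝ × ℝ) r, π (Φ p) = Ψ p := by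
    intro p hp
    rw [← hsrc] at hp
    rw [he]
    exact e.right_inv (htgt (Ψ.map_source hp))
  have hsb : ((s, 0) : ℝ × ℝ) ∈ Metric.ball ((s, 0) : ℝ × ℝ) r := Metric.mem_ball_self hr
  have hΦ0 : Φ (s, 0) = x := by
    show e.symm (Ψ (s, 0)) = x
    rw [hΨ0, ← hx, he, e.left_inv hxe]
  have hsupp : ∀ p ∈ Metric.ball ((s, 0) : ℝ × ℝ) r, π (Φ p) ∈ E.support ↔ p.2 = 0 := by
    intro p hp
    rw [hπΦ p hp]
    exact hΨs p (hsrc ▸ hp)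
  -- The sign `ε` treats both half-balls at once. Each is convex and off the graph, so it lies in
  -- one polygon, and that polygon accumulates at every point of the dividing line.
  have half : ∀ ε : ℝ, |ε| = 1 → ∃ a : S,
      (∀ p ∈ Metric.ball ((s, 0) : ℝ × ℝ) r, 0 < ε * p.2 →
        liftedPolygon π E (Φ p) = liftedPolygon π E a) ∧
      ∀ p ∈ Metric.ball ((s, 0) : ℝ × ℝ) r, p.2 = 0 → Φ p ∈ closure (liftedPolygon π E a) := by
    intro ε hε
    have hεε : ε * ε = 1 := by rw [← abs_mul_abs_self, hε, one_mul]
    have hconv : Convex ℝ (Metric.ball ((s, 0) : ℝ × ℝ) r ∩ {p | 0 < ε * p.2}) := by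
      refine (convex_ball _ _).inter (convex_halfSpace_gt (f := fun p : ℝ × ℝ => ε * p.2) ?_ 0)
      exact ⟨fun p q => by simp [mul_add], fun c p => by simp [mul_left_comm]⟩
    have hb : ((s, ε * (r / 2)) : ℝ × ℝ) ∈ Metric.ball ((s, 0) : ℝ × ℝ) r := by
      simp [Prod.dist_eq, hε, abs_of_pos hr, hr]
    have h1 : ∀ p ∈ Metric.ball ((s, 0) : ℝ × ℝ) r, 0 < ε * p.2 →
        liftedPolygon π E (Φ p) = liftedPolygon π E (Φ (s, ε * (r / 2))) := by
      intro p hp hp0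
      refine liftedPolygon_eq_of_isPreconnected hconv.isPreconnected
        (Φ.continuousOn.mono (hΦs ▸ Set.inter_subset_left)) ?_ ⟨hp, hp0⟩ ⟨hb, ?_⟩
      · rintro p ⟨hp, hp0⟩
        rw [hsupp p hp]
        rintro h
        simp [h] at hp0
      · show 0 < ε * (ε * (r / 2))
        rw [← mul_assoc, hεε, one_mul]
        positivity
    refine ⟨_, h1, ?_⟩
    rintro ⟨u, v⟩ hp hv
    obtain rfl : v = 0 := hv
    have hlim : Filter.Tendsto (fun τ : ℝ => ((u, ε * τ) : ℝ × ℝ)) (𝓝[>] 0) (𝓝 (u, 0)) := by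
      have : ContinuousAt (fun τ : ℝ => ((u, ε * τ) : ℝ × ℝ)) 0 := by fun_prop
      simpa [ContinuousAt] using this.tendsto.mono_left nhdsWithin_le_nhds
    refine mem_closure_of_tendsto ((Φ.continuousAt (hΦs.symm ▸ hp)).tendsto.comp hlim) ?_
    filter_upwards [hlim (Metric.isOpen_ball.mem_nhds hp), self_mem_nhdsWithin] with τ hτ hτ0
    have hτ1 : 0 < ε * (ε * τ) := by
      rw [← mul_assoc, hεε, one_mul]
      exact hτ0
    rw [← h1 _ hτ hτ1]
    refine mem_liftedPolygon_self ?_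
    show π (Φ (u, ε * τ)) ∉ _
    rw [hsupp _ hτ]
    rintro h
    simp [show ε * τ = 0 from h] at hτ1
  obtain ⟨a, ha, ha'⟩ := half 1 (by simp)
  obtain ⟨b, hb, hb'⟩ := half (-1) (by simp)
  have hN : Φ.target ∈ 𝓝 x := by
    refine Φ.open_target.mem_nhds ?_
    rw [← hΦ0]
    exact Φ.map_source (hΦs.symm ▸ hsb)
  have hNΦ : ∀ x' ∈ Φ.target, ∃ p ∈ Metric.ball ((s, 0) : ℝ × ℝ) r, Φ p = x' := fun x' hx' =>
    ⟨Φ.symm x', hΦs ▸ Φ.map_target hx', Φ.right_inv hx'⟩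
  refine ⟨Φ.target, hN, a, b, ?_, ?_⟩
  · intro x' hx' hx'i y hy
    constructor
    · intro hcl
      obtain ⟨z, hzN, hzC⟩ := mem_closure_iff.1 hcl _ Φ.open_target hx'
      obtain ⟨p, hp, rfl⟩ := hNΦ z hzN
      have hps : π (Φ p) ∉ E.support := connectedComponentIn_subset _ _ hzC
      rw [hsupp p hp] at hps
      rw [← liftedPolygon_eq_of_mem hzC]
      rcases lt_or_gt_of_ne hps with h | h
      · exact Or.inr (hb p hp (by linarith))
      · exact Or.inl (ha p hp (by linarith))
    · obtain ⟨p, hp, rfl⟩ := hNΦ x' hx'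
      have hp0 := (hsupp p hp).1 (E.openEdge_subset_support i hx'i)
      rintro (h | h) <;> rw [h]
      · exact ha' p hp hp0
      · exact hb' p hp hp0
  · intro Γ t hΓt hΓc hΓw
    have h1 := hΨγ (fun τ => π (Γ τ)) t (by rw [hΓt, hx]) (hπ.continuous.continuousAt.comp hΓc) hΓw
    filter_upwards [h1, hΓc.eventually (hΓt.symm ▸ hN)] with τ hτ hτN
    obtain ⟨p, hp, hpτ⟩ := hNΦ _ hτN
    have hp2 : Ψ.symm (π (Γ τ)) = p := by
      rw [← hpτ, hπΦ p hp]
      exact Ψ.left_inv (hsrc.symm ▸ hp)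
    rw [hp2] at hτ
    rw [← hpτ]
    constructor
    · intro h
      refine ha p hp ?_
      rw [sign_pos (sub_pos.2 h), sign_eq_one_iff] at hτ
      linarith
    · intro h
      refine hb p hp ?_
      rw [sign_neg (sub_neg.2 h), sign_eq_neg_one_iff] at hτ
      linarith

/-- Whether a point of a lifted edge lies in the closure of a given polygon does not depend on the
point. -/
theorem mem_closure_liftedPolygon_iff (hπ : IsConformalQuotient G π) {E : EmbeddedGraph T k}
    (hE : conePoints G π ⊆ E.vertices) {i : Fin k} {A : Set S} (hA : IsPreconnected A)
    (hAi : A ⊆ π ⁻¹' E.openEdge i) {x x' : S} (hx : x ∈ A) (hx' : x' ∈ A) {y : S}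
    (hy : π y ∉ E.support) :
    x ∈ closure (liftedPolygon π E y) ↔ x' ∈ closure (liftedPolygon π E y) := by
  -- Membership in the closure is locally constant along the edge, because nearby points see the
  -- same two sides; preconnectedness makes it constant.
  refine hA.induction₂ (fun x x' => x ∈ closure (liftedPolygon π E y) ↔
    x' ∈ closure (liftedPolygon π E y)) ?_ (fun _ _ _ _ _ _ => Iff.trans)
    (fun _ _ _ _ => Iff.symm) hx hx'
  intro z hz
  obtain ⟨s, hs, hsz⟩ := hAi hz
  have hv := E.regular_arc i s hs
  -- No crossing curve is involved here, so any transverse direction serves.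
  have hind : LinearIndependent ℝ
      ![chartVelocity (E.arc i) s, Complex.I * chartVelocity (E.arc i) s] := by
    rw [LinearIndependent.pair_iff]
    intro a b hab
    have h1 : ((a : ℂ) + b * Complex.I) * chartVelocity (E.arc i) s = 0 := by
      rw [← hab]
      simp only [Complex.real_smul]
      ring
    have h2 := (mul_eq_zero.1 h1).resolve_right hv
    exact ⟨by simpa using congrArg Complex.re h2, by simpa using congrArg Complex.im h2⟩
  obtain ⟨N, hN, a, b, hab, -⟩ := hπ.exists_sides hE hs hind hsz.symm
  filter_upwards [mem_nhdsWithin_of_mem_nhds hN, self_mem_nhdsWithin] with z' hz'N hz'A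
  rw [hab z (mem_of_mem_nhds hN) (hAi hz) y hy, hab z' hz'N (hAi hz'A) y hy]

end IsConformalQuotient

/-! ### Open edges as intervals, and translates of polygons -/

namespace EmbeddedGraph

/-- An open edge is homeomorphic to the open unit interval. -/
theorem nonempty_homeomorph_openEdge {T : Type*} [TopologicalSpace T] [T2Space T]
    [ChartedSpace ℂ T] {k : ℕ} (E : EmbeddedGraph T k) (i : Fin k) :
    Nonempty (Set.Ioo (0 : ℝ) 1 ≃ₜ E.openEdge i) := by
  let f : Set.Ioo (0 : ℝ) 1 ≃ E.openEdge i := Set.BijOn.equiv (E.arc i) (E.injOn_arc i).bijOn_image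
  have hf : ∀ t, (f t : T) = E.arc i t := fun t => rfl
  refine ⟨f.toHomeomorphOfContinuousClosed ?_ ?_⟩
  · exact (((E.continuousOn_arc i).mono Set.Ioo_subset_Icc_self).domRestrict).subtype_mk _
  -- A relatively closed set is the trace of a closed `D`. The image of `[0, 1] ∩ D` is compact, and
  -- the end points it may add go to vertices, off the open edge.
  · intro C hC
    obtain ⟨D, hD, rfl⟩ := isClosed_induced_iff.1 hC
    refine isClosed_induced_iff.2 ⟨E.arc i '' (Set.Icc 0 1 ∩ D), ((isCompact_Icc.inter_right
      hD).image_of_continuousOn ((E.continuousOn_arc i).mono Set.inter_subset_left)).isClosed, ?_⟩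
    ext y
    constructor
    · rintro ⟨t, ⟨ht, htD⟩, hty⟩
      have ht' : t ∈ Set.Ioo (0 : ℝ) 1 := by
        by_contra h
        exact E.notMem_vertices_of_mem_openEdge y.2 (hty ▸ E.arc_mem_vertices ht h)
      exact ⟨⟨t, ht'⟩, htD, Subtype.ext hty⟩
    · rintro ⟨t, ht, rfl⟩
      exact ⟨t, ⟨Set.Ioo_subset_Icc_self t.2, ht⟩, rfl⟩

theorem IsCrossoverLoop.notMem_vertices {T : Type*} [TopologicalSpace T] [ChartedSpace ℂ T] {k : ℕ}
    {E : EmbeddedGraph T k} {i : Fin k} {v₀ : T} {γ : Path v₀ v₀}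
    (hγ : E.IsCrossoverLoop i γ) (t : unitInterval) : γ t ∉ E.vertices := by
  obtain ⟨t₀, -, s, hs, hts, hoff, -⟩ := hγ.crossing
  have h1 : γ t = γ.extend t := by simp
  rw [h1]
  by_cases h : (t : ℝ) = t₀
  · rw [h, hts]
    exact E.arc_notMem i s hs
  · exact fun hv => hoff t t.2 h (Or.inl hv)

end EmbeddedGraph

theorem IsConformalQuotient.smul_liftedPolygon {G S T : Type*} [Group G]
    [TopologicalSpace S] [ChartedSpace ℂ S] [MulAction G S] [TopologicalSpace T] [ChartedSpace ℂ T]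
    {π : S → T} {k : ℕ} {E : EmbeddedGraph T k} {x₀ : S} (hπ : IsConformalQuotient G π) (g : G)
    (hx₀ : π x₀ ∉ E.support) :
    g • liftedPolygon π E x₀ = liftedPolygon π E (g • x₀) :=
  hπ.smul_connectedComponentIn (A := E.supportᶜ) g hx₀

theorem IsConformalQuotient.mem_closure_liftedPolygon_smul_iff {G S T : Type*} [Group G]
    [TopologicalSpace S] [ChartedSpace ℂ S] [MulAction G S] [TopologicalSpace T] [ChartedSpace ℂ T]
    {π : S → T} {k : ℕ} {E : EmbeddedGraph T k} {x₀ : S} (hπ : IsConformalQuotient G π)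
    (hx₀ : π x₀ ∉ E.support) (a c : G) (q : S) :
    a • q ∈ closure (liftedPolygon π E (c • x₀)) ↔
      q ∈ closure (liftedPolygon π E ((a⁻¹ * c) • x₀)) := by
  have := hπ.continuousConstSMul
  have h : liftedPolygon π E (c • x₀) = a • liftedPolygon π E ((a⁻¹ * c) • x₀) := by
    rw [hπ.smul_liftedPolygon a (by rwa [hπ.map_smul]), ← mul_smul, mul_inv_cancel_left]
  rw [h, closure_smul, Set.smul_mem_smul_set_iff]

/-! ### Monodromy, crossings and shared edges -/

namespace IsConformalQuotient

variable {G S T : Type*} [Group G] [Finite G] [TopologicalSpace S] [T2Space S] [CompactSpace S]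
  [ChartedSpace ℂ S] [MulAction G S] [TopologicalSpace T] [T2Space T] [ChartedSpace ℂ T] {π : S → T}
  {k : ℕ} {x₀ : S}

theorem exists_lift_monodromy (hπ : IsConformalQuotient G π) (γ : Path (π x₀) (π x₀))
    (hγ : ∀ t, γ t ∉ conePoints G π) :
    ∃ Γ : Path x₀ (monodromy G π x₀ γ • x₀), ∀ t, π (Γ t) = γ t := by
  have h : ∃ g : G, ∃ Γ : Path x₀ (g • x₀), ∀ t, π (Γ t) = γ t := by
    have hx₀ : π x₀ ∈ (conePoints G π)ᶜ := by simpa using hγ 0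
    obtain ⟨Γ, hΓ, hΓ0⟩ := hπ.isCoveringMapOn.isCoveringMap_restrictPreimage.exists_path_lifts
      (γ := ⟨fun t => (⟨γ t, hγ t⟩ : ((conePoints G π)ᶜ : Set T)), by fun_prop⟩)
      (e := ⟨x₀, hx₀⟩) (by ext; simp)
    have hΓ' : ∀ t, π (Γ t) = γ t := fun t => congrArg Subtype.val (congrFun hΓ t)
    obtain ⟨g, hg⟩ := (hπ.fibre_iff x₀ (Γ 1)).1 (by rw [hΓ', γ.target])
    exact ⟨g, ⟨⟨fun t => (Γ t : S), by fun_prop⟩, congrArg Subtype.val hΓ0, hg.symm⟩, hΓ'⟩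
  rw [monodromy, dif_pos h]
  exact h.choose_spec

/-- Lifts from `x₀` are unique, so their end points agree, and the stabilizer of `x₀` is trivial. -/
theorem monodromy_eq (hπ : IsConformalQuotient G π) {γ : Path (π x₀) (π x₀)}
    (hγ : ∀ t, γ t ∉ conePoints G π) {g : G} (Γ : Path x₀ (g • x₀)) (hΓ : ∀ t, π (Γ t) = γ t) :
    monodromy G π x₀ γ = g := by
  obtain ⟨Γ', hΓ'⟩ := hπ.exists_lift_monodromy γ hγ
  have h := hπ.isCoveringMapOn.eqOn_of_comp_eqOn (f₁ := Γ') (f₂ := Γ) isPreconnected_univ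
    Γ'.continuous.continuousOn Γ.continuous.continuousOn (fun t _ => by rw [hΓ, hΓ'])
    (fun t _ => by rw [hΓ']; exact hγ t) (Set.mem_univ 0) (by simp) (Set.mem_univ 1)
  rw [Γ.target, Γ'.target] at h
  have hx₀ : π x₀ ∉ conePoints G π := by simpa using hγ 0
  have h1 := eq_one_of_smul_eq_self hx₀ (g := g⁻¹ * monodromy G π x₀ γ) (by
    rw [mul_smul, h, inv_smul_smul])
  exact (inv_mul_eq_one.1 h1).symm

theorem monodromy_symm (hπ : IsConformalQuotient G π) {γ : Path (π x₀) (π x₀)}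
    (hγ : ∀ t, γ t ∉ conePoints G π) :
    monodromy G π x₀ γ.symm = (monodromy G π x₀ γ)⁻¹ := by
  have := hπ.continuousConstSMul
  obtain ⟨Γ, hΓ⟩ := hπ.exists_lift_monodromy γ hγ
  -- The reversed lift starts at `ξ • x₀`, with `ξ` the monodromy of `γ`; translating it by `ξ⁻¹`
  -- makes it run from `x₀` to `ξ⁻¹ • x₀`.
  refine hπ.monodromy_eq (γ := γ.symm) (fun t => hγ _)
    ((Γ.symm.map (continuous_const_smul (monodromy G π x₀ γ)⁻¹)).cast
      (inv_smul_smul _ _).symm rfl) fun t => ?_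
  simp [hπ.map_smul, hΓ, Path.symm_apply]

variable {E : EmbeddedGraph T k}

theorem liftedPolygon_smul_inj (hπ : IsConformalQuotient G π)
    (hE : E.IsCutSystem (conePoints G π)) (hx₀ : π x₀ ∉ E.support) {g h : G} :
    liftedPolygon π E (g • x₀) = liftedPolygon π E (h • x₀) ↔ g = h := by
  refine ⟨fun heq => ?_, fun heq => heq ▸ rfl⟩
  obtain ⟨e⟩ := hE.complement_disc
  have : ContractibleSpace (Metric.ball (0 : ℂ) 1) :=
    Metric.contractibleSpace_ball one_pos
  have : LocallyPathConnectedSpace (Metric.ball (0 : ℂ) 1) :=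
    Metric.isOpen_ball.locallyPathConnectedSpace
  have hmem : g • x₀ ∈ liftedPolygon π E (g • x₀) :=
    mem_liftedPolygon_self (by rwa [hπ.map_smul])
  rw [heq, ← hπ.smul_liftedPolygon h hx₀, Set.mem_smul_set_iff_inv_smul_mem, ← mul_smul] at hmem
  refine (inv_mul_eq_one.1 (hπ.eq_one_of_smul_mem_connectedComponentIn (A := E.supportᶜ)
    (fun y hy hc => hy (Or.inl (hE.cone_subset hc))) e.symm hx₀ hmem)).symm

/-- The lift of a crossover loop crosses a lifted edge, whose adjacent polygons are the polygons
of the two end points of the lift. -/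
theorem exists_crossing (hπ : IsConformalQuotient G π) (hE : conePoints G π ⊆ E.vertices)
    {i : Fin k} {γ : Path (π x₀) (π x₀)} (hγ : E.IsCrossoverLoop i γ) :
    ∃ q : S, π q ∈ E.openEdge i ∧ ∀ y, π y ∉ E.support →
      (q ∈ closure (liftedPolygon π E y) ↔ liftedPolygon π E y = liftedPolygon π E x₀ ∨
        liftedPolygon π E y = liftedPolygon π E (monodromy G π x₀ γ • x₀)) := by
  obtain ⟨Γ, hΓ⟩ := hπ.exists_lift_monodromy γ fun t h => hγ.notMem_vertices t (hE h)
  have hΓ' : ∀ τ : ℝ, π (Γ.extend τ) = γ.extend τ := fun τ => hΓ _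
  obtain ⟨t, ht, s, hs, hts, hoff, hind⟩ := hγ.crossing
  obtain ⟨N, hN, a, b, hclos, hcross⟩ := hπ.exists_sides hE hs hind
    (x := Γ.extend t) (by rw [hΓ', hts])
  have hcurve := hcross Γ.extend t rfl Γ.continuous_extend.continuousAt
    (by rw [funext hΓ'])
  -- Before time `t` the lift avoids the graph, so it stays in the polygon of `x₀` until it reaches
  -- the box; after `t` it likewise stays in the polygon of its end point.
  have hb : liftedPolygon π E x₀ = liftedPolygon π E b := by
    obtain ⟨τ, hτ, hτ0, hτt⟩ := ((hcurve.filter_mono nhdsWithin_le_nhds).and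
      (Ioo_mem_nhdsLT ht.1)).exists
    rw [← hτ.2 hτt]
    refine (congrArg _ Γ.extend_zero.symm).trans (liftedPolygon_eq_of_isPreconnected
      (A := Set.Ico 0 t) isPreconnected_Ico Γ.continuous_extend.continuousOn (fun u hu => ?_)
      ⟨le_rfl, ht.1⟩ ⟨hτ0.le, hτt⟩)
    rw [hΓ']
    exact hoff u ⟨hu.1, hu.2.le.trans ht.2.le⟩ hu.2.ne
  have ha : liftedPolygon π E (monodromy G π x₀ γ • x₀) = liftedPolygon π E a := by
    obtain ⟨τ, hτ, hτt, hτ1⟩ := ((hcurve.filter_mono nhdsWithin_le_nhds).and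
      (Ioo_mem_nhdsGT ht.2)).exists
    rw [← hτ.1 hτt]
    refine (congrArg _ Γ.extend_one.symm).trans (liftedPolygon_eq_of_isPreconnected
      (A := Set.Ioc t 1) isPreconnected_Ioc Γ.continuous_extend.continuousOn (fun u hu => ?_)
      ⟨ht.2, le_rfl⟩ ⟨hτt, hτ1.le⟩)
    rw [hΓ']
    exact hoff u ⟨ht.1.le.trans hu.1.le, hu.2⟩ hu.1.ne'
  have hq : π (Γ.extend t) ∈ E.openEdge i := ⟨s, hs, by rw [hΓ', hts]⟩
  refine ⟨Γ.extend t, hq, fun y hy => ?_⟩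
  rw [hclos _ (mem_of_mem_nhds hN) hq y hy, ha, hb, or_comm]

/-- The lifted edges shared by two different polygons are parametrized by the oriented edges with
the corresponding crossover transformation. -/
theorem exists_sharedEdges_eq_image (hπ : IsConformalQuotient G π)
    (hE : E.IsCutSystem (conePoints G π)) (hx₀ : π x₀ ∉ E.support)
    {δ : Fin k → Path (π x₀) (π x₀)} (hδ : ∀ i, E.IsCrossoverLoop i (δ i)) {g h : G}
    (hgh : g ≠ h) :
    ∃ m : Fin k × Bool → Set S, Function.Injective m ∧
      sharedEdges π E (g • liftedPolygon π E x₀) (h • liftedPolygon π E x₀) =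
        m '' {p | crossover G π x₀ δ p = g⁻¹ * h} := by
  have hdisj : ∀ i, ∀ y ∈ E.openEdge i, y ∉ conePoints G π := fun i y hy hc =>
    E.notMem_vertices_of_mem_openEdge hy (hE.cone_subset hc)
  choose q hq hqcl using fun i => hπ.exists_crossing hE.cone_subset (hδ i)
  have : ContractibleSpace (Set.Ioo (0 : ℝ) 1) :=
    (convex_Ioo (0 : ℝ) 1).contractibleSpace ⟨1 / 2, by norm_num⟩
  have : LocallyPathConnectedSpace (Set.Ioo (0 : ℝ) 1) := isOpen_Ioo.locallyPathConnectedSpace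
  let ξ : Fin k → G := fun i => monodromy G π x₀ (δ i)
  have hξf : ∀ i, crossover G π x₀ δ (i, false) = (ξ i)⁻¹ := fun i =>
    hπ.monodromy_symm fun t hc => (hδ i).notMem_vertices t (hE.cone_subset hc)
  let D : Fin k → G → Set S := fun i a => connectedComponentIn (π ⁻¹' E.openEdge i) (a • q i)
  have hqa : ∀ i (a : G), a • q i ∈ π ⁻¹' E.openEdge i := fun i a => by
    rw [Set.mem_preimage, hπ.map_smul]
    exact hq i
  have hDmem : ∀ i a, a • q i ∈ D i a := fun i a => mem_connectedComponentIn (hqa i a)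
  have hDsub : ∀ i a, D i a ⊆ π ⁻¹' E.openEdge i := fun i a => connectedComponentIn_subset _ _
  have hDlift : ∀ e, e ∈ liftedEdges π E ↔ ∃ i a, e = D i a := by
    intro e
    constructor
    · rintro ⟨i, x, hx, rfl⟩
      obtain ⟨f⟩ := E.nonempty_homeomorph_openEdge i
      obtain ⟨a, ha⟩ := hπ.exists_mem_connectedComponentIn (hdisj i) f (hq i) hx
      exact ⟨i, a, (connectedComponentIn_eq ha).symm⟩
    · rintro ⟨i, a, rfl⟩
      exact ⟨i, _, hqa i a, rfl⟩
  have hDinj : ∀ i j a b, D i a = D j b → i = j ∧ a = b := by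
    intro i j a b hab
    have hmem : a • q i ∈ D j b := hab ▸ hDmem i a
    obtain rfl : i = j := E.openEdge_eq_of_mem (hqa i a) (hDsub j b hmem)
    refine ⟨rfl, ?_⟩
    obtain ⟨f⟩ := E.nonempty_homeomorph_openEdge i
    have h1 : D i b = b • connectedComponentIn (π ⁻¹' E.openEdge i) (q i) :=
      (hπ.smul_connectedComponentIn b (hq i)).symm
    rw [h1, Set.mem_smul_set_iff_inv_smul_mem, ← mul_smul] at hmem
    exact (inv_mul_eq_one.1
      (hπ.eq_one_of_smul_mem_connectedComponentIn (hdisj i) f (hq i) hmem)).symm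
  have hsupp : ∀ c : G, π (c • x₀) ∉ E.support := fun c => by rwa [hπ.map_smul]
  -- It suffices to test the single point `a • q i`, and translation by `a⁻¹` reduces this to the
  -- crossing at `q i`.
  have hDcl : ∀ i a (c : G), D i a ⊆ closure (c • liftedPolygon π E x₀) ↔
      c = a ∨ c = a * ξ i := by
    intro i a c
    rw [hπ.smul_liftedPolygon c hx₀]
    have h1 : D i a ⊆ closure (liftedPolygon π E (c • x₀)) ↔
        a • q i ∈ closure (liftedPolygon π E (c • x₀)) :=
      ⟨fun hs => hs (hDmem i a), fun hm x hx => (hπ.mem_closure_liftedPolygon_iff hE.cone_subset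
        isPreconnected_connectedComponentIn (hDsub i a) hx (hDmem i a) (hsupp c)).2 hm⟩
    have h2 : liftedPolygon π E x₀ = liftedPolygon π E ((1 : G) • x₀) := by rw [one_smul]
    rw [h1, hπ.mem_closure_liftedPolygon_smul_iff hx₀, hqcl i _ (hsupp _), h2,
      hπ.liftedPolygon_smul_inj hE hx₀, hπ.liftedPolygon_smul_inj hE hx₀, inv_mul_eq_one,
      inv_mul_eq_iff_eq_mul, eq_comm (a := a)]
  -- The forward orientation takes the lift with `a = g`, the backward one that with `a = h`. They
  -- are distinct since `g ≠ h`.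
  refine ⟨fun p => D p.1 (if p.2 then g else h), ?_, ?_⟩
  · rintro ⟨i, u⟩ ⟨j, v⟩ huv
    obtain ⟨rfl, h2⟩ := hDinj _ _ _ _ huv
    cases u <;> cases v <;> simp_all [eq_comm]
  · ext e
    simp only [sharedEdges, Set.mem_ofPred_eq, Set.subset_inter_iff, hDlift, Set.mem_image]
    constructor
    · rintro ⟨⟨i, a, rfl⟩, hg, hh⟩
      rw [hDcl] at hg hh
      rcases hg with rfl | hg
      · refine ⟨(i, true), ?_, rfl⟩
        rw [hh.resolve_left hgh.symm, inv_mul_cancel_left]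
        rfl
      · rcases hh with rfl | hh
        · refine ⟨(i, false), ?_, rfl⟩
          rw [hξf, hg, mul_inv_rev, inv_mul_cancel_right]
        · exact absurd (hg.trans hh.symm) hgh
    · rintro ⟨⟨i, u⟩, hp, rfl⟩
      refine ⟨⟨i, _, rfl⟩, ?_⟩
      rw [hDcl, hDcl]
      cases u
      · rw [hξf, inv_eq_iff_eq_inv, mul_inv_rev, inv_inv] at hp
        exact ⟨Or.inr (by simp [hp]), Or.inl (by simp)⟩
      · have hp' : ξ i = g⁻¹ * h := hp
        exact ⟨Or.inl (by simp), Or.inr (by simp [hp'])⟩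

end IsConformalQuotient

/-! ### Passage to an ordered crossover sequence -/

theorem mainTheorem3 {G S T : Type*} [Group G] [Finite G]
    [TopologicalSpace S] [T2Space S] [CompactSpace S] [ConnectedSpace S]
    [ChartedSpace ℂ S] [IsManifold 𝓘(ℂ) ω S] [MulAction G S] [FaithfulSMul G S]
    [TopologicalSpace T] [T2Space T] [ChartedSpace ℂ T] [IsManifold 𝓘(ℂ) ω T]
    (π : S → T) (hπ : IsConformalQuotient G π)
    {k : ℕ} (E : EmbeddedGraph T k) (hE : E.IsCutSystem (conePoints G π))
    (x₀ : S) (hx₀ : π x₀ ∉ E.support)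
    (δ : Fin k → Path (π x₀) (π x₀)) (hδ : ∀ i, E.IsCrossoverLoop i (δ i))
    (ord : Fin (2 * k) ≃ Fin k × Bool)
    (g h : G) (hgh : g • liftedPolygon π E x₀ ≠ h • liftedPolygon π E x₀) :
    ((sharedEdges π E (g • liftedPolygon π E x₀) (h • liftedPolygon π E x₀)).Nonempty ↔
      ∃ j, crossoverSequence G π x₀ δ ord j = g⁻¹ * h) ∧
    (sharedEdges π E (g • liftedPolygon π E x₀) (h • liftedPolygon π E x₀)).encard =
      {j | crossoverSequence G π x₀ δ ord j = g⁻¹ * h}.encard := by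
  obtain ⟨m, hm, hshared⟩ := hπ.exists_sharedEdges_eq_image hE hx₀ hδ
    (fun hgh' => hgh (by rw [hgh']) : g ≠ h)
  have hord : {p | crossover G π x₀ δ p = g⁻¹ * h} =
      ord '' {j | crossoverSequence G π x₀ δ ord j = g⁻¹ * h} := by
    ext p
    simp [crossoverSequence]
  rw [hshared, hord, hm.encard_image, ord.injective.encard_image, Set.image_nonempty,
    Set.image_nonempty]
  exact ⟨Iff.rfl, rfl⟩
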